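/- A word is a finite sequence of positive integers; $\mathbb P=\{1,2,\dots\}$, $[k]=\{1,\dots,k\}$, and $\mathrm{des}(w)=|\{i: w_i>w_{i+1}\}|$. The reduction $\mathrm{red}(w)$ replaces every occurrence of the $i$-th smallest letter of $w$ by $i$. Let $u=u_1\cdots u_j$ be a word with $\mathrm{red}(u)=u$. A $u$-match in $w$ is a factor (block of consecutive letters) $v$ of $w$ with $\mathrm{red}(v)=u$; an exact $u$-match is a factor $v=u$. Factors are distinguished by their positions. For a word $w$ write $\overline z^{\,w}=\prod_i z_{w_i}$. For $A=\mathbb P$ or $A=[k]$ define the formal power series $$\mathcal N^{(A)}_u=1+\sum_{n\ge1}t^n\sum_{w}x^{\mathrm{des}(w)+1}\,\overline z^{\,w},$$ the inner sum being over the words $w\in A^n$ without $u$-matches, and define $\mathcal{EN}^{(A)}_u$ in the same way with exact $u$-matches in place of $u$-matches. Two $u$-matches in $w$ starting at positions $p<q$ are linked if $q<p+j-1$, i.e. if the last letter of the first is neither the first nor the last letter of the second but lies inside it. A word $w$ is a linked block if a $u$-match starts at its first letter, a $u$-match ends at its last letter, and any two consecutive $u$-matches in $w$ are linked. For letters $b>a$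 in $A$ put $$wt_{u,A}(ba)=\sum_{w}(-x)^{m(w)}\,t^{|w|-2}\,\prod_{1<i<|w|}z_{w_i},$$ the sum over the linked blocks $w=w_1\cdots w_{|w|}$ over $A$ with first letter $b$ and last letter $a$, where $m(w)$ is the number of $u$-matches in $w$. Define $ewt_{u,A}(ba)$ in the same way with exact $u$-matches. For a finite set $S=\{j_1<\dots<j_r\}\subseteq A$, $r\ge1$, let $$DXTZ_{u,A}(S)=z_{j_1}\cdots z_{j_r}\prod_{i=1}^{r-1}\bigl(wt_{u,A}(j_{i+1}j_i)+x-1\bigr),$$ and let $EDXTZ_{u,A}(S)$ be the same with $ewt_{u,A}$ in place of $wt_{u,A}$. **Theorem.** Suppose that $\mathrm{red}(u)=u$, $\mathrm{des}(u)=1$ and $u_1>u_j$. Then, as formal power series over $\mathbb Z$ in $x,t,z_1,z_2,\dots$ (the denominators being invertible), $$\mathcal N^{(A)}_u=\frac{1-(1-x)\sum_{n\ge1}t^n\sum_{S\subseteq A,\,|S|=n}DXTZ_{u,A}(S)}{1-\sum_{n\ge1}t^n\sum_{S\subseteq A,\,|S|=n}DXTZ_{u,A}(S)},\qquad \mathcal{EN}^{(A)}_u=\frac{1-(1-x)\sum_{n\ge1}t^n\sum_{S\subseteq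 A,\,|S|=n}EDXTZ_{u,A}(S)}{1-\sum_{n\ge1}t^n\sum_{S\subseteq A,\,|S|=n}EDXTZ_{u,A}(S)}$$ for $A=\mathbb P$, and for $A=[k]$ whenever $u\in[k]^*$. Moreover, if $u\in[k]^*$, then setting $z_i=0$ for all $i>k$ turns $\mathcal N^{(\mathbb P)}_u$ and $\sum_{n\ge1}t^n\sum_{S\subseteq\mathbb P,\,|S|=n}DXTZ_{u,\mathbb P}(S)$ into the corresponding series for $A=[k]$, and $DXTZ_{u,\mathbb P}(S)$ into $DXTZ_{u,[k]}(S)$ for every finite $S\subseteq[k]$; the same holds for the exact versions. -/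

import Mathlib

open scoped MvPowerSeries.WithPiTopology

namespace PatWord

/-! ## Words over the positive integers -/

/-- A word over the positive integers. -/
abbrev Word := List ℕ+

/-- The alphabet `[k] = {1, …, k}`. -/
def alphabet (k : ℕ) : Set ℕ+ := {i | (i : ℕ) ≤ k}

/-- The reduction of a word: every occurrence of its `i`-th smallest letter is replaced by `i`
(one plus the number of distinct letters of `w` that are smaller). -/
def red (w : Word) : Word :=
  w.map fun a => Nat.succPNat (w.toFinset.filter fun b => b < a).card

/-- The number of descents, i.e. of positions `i` with `w_i > w_{i+1}`. -/
def des (w : Word) : ℕ := (w.zip w.tail).countP fun p => p.2 < p.1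

/-- The word `v` has the shape of a `u`-match. -/
def IsMatch (u v : Word) : Prop := red v = u

/-- The word `v` has the shape of an exact `u`-match. -/
def IsExactMatch (u v : Word) : Prop := v = u

open Classical in
/-- The (0-based) starting positions of the factors `v` of `w` of length `|u|` with `R u v`. With
`R = IsMatch` these are the `u`-matches in `w`, with `R = IsExactMatch` the exact `u`-matches. -/
noncomputable def matchPositions (R : Word → Word → Prop) (u w : Word) : Finset ℕ :=
  (Finset.range (w.length + 1 - u.length)).filter fun p => R u ((w.drop p).take u.length)

/-- The number of (exact) `u`-matches in `w`. -/
noncomputable def mch (R : Word → Word → Prop) (u w : Word) : ℕ := (matchPositions R u w).card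

/-! ## Formal power series -/

/-- The variables `x`, `t` and `z_i` for a positive integer `i`. -/
inductive Var
  | x
  | t
  | z (i : ℕ+)

/-- Formal power series over `ℤ` in the variables `x, t, z_1, z_2, …`. Infinite sums are taken in
the product topology of the discrete ring `ℤ`, that is, coefficient by coefficient. -/
abbrev PS := MvPowerSeries Var ℤ

noncomputable def x : PS := MvPowerSeries.X Var.x

noncomputable def t : PS := MvPowerSeries.X Var.t

noncomputable def z (i : ℕ+) : PS := MvPowerSeries.X (Var.z i)

/-- `z_{w_1} ⋯ z_{w_n}`. -/
noncomputable def zWord (w : Word) : PS := (w.map z).prod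

/-- The substitution `z_i = 0` for all `i > k` (the other variables are kept). -/
noncomputable def setZero (k : ℕ) : PS →+* PS :=
  MvPowerSeries.rescale fun v =>
    match v with
    | Var.x => 1
    | Var.t => 1
    | Var.z i => if (i : ℕ) ≤ k then 1 else 0

/-! ## The generating functions of words without matches -/

/-- Words of length `n` over the alphabet `A` without (exact) `u`-matches. -/
def Avoiding (R : Word → Word → Prop) (u : Word) (A : Set ℕ+) (n : ℕ) :=
  {w : Word // w.length = n ∧ (∀ a ∈ w, a ∈ A) ∧ mch R u w = 0}

/-- The sum of `x^{des(w)+1} z^w` over the words `w` of length `n` over `A` without matches. -/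
noncomputable def avoidSum (R : Word → Word → Prop) (u : Word) (A : Set ℕ+) (n : ℕ) : PS :=
  ∑' w : Avoiding R u A n, x ^ (des w.1 + 1) * zWord w.1

/-- The generating function `1 + ∑_{n ≥ 1} t^n ∑_w x^{des(w)+1} z^w`. -/
noncomputable def avoidGF (R : Word → Word → Prop) (u : Word) (A : Set ℕ+) : PS :=
  1 + ∑' n : ℕ, t ^ (n + 1) * avoidSum R u A (n + 1)

/-! ## The weights of the collapse map -/

/-- Two matches of length `ℓ`, the first starting at `p` and the second at `q > p`, are linked if
the last position `p + ℓ - 1` of the first is neither the first nor the last position of the second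
but lies strictly between them. (The first position `p` of the first is never in the second, and
`p + ℓ - 1 < q + ℓ - 1` is automatic.) -/
def Linked (ℓ p q : ℕ) : Prop := p < q ∧ q + 1 < p + ℓ

/-- A block of linked matches: some match starts at the first letter of `w`, some match ends at its
last letter, and any two consecutive matches in `w` are linked. -/
def IsLinkedBlock (R : Word → Word → Prop) (u w : Word) : Prop :=
  u.length ≤ w.length ∧
  0 ∈ matchPositions R u w ∧
  w.length - u.length ∈ matchPositions R u w ∧
  ∀ p ∈ matchPositions R u w, ∀ q ∈ matchPositions R u w, p < q →
    (∀ r ∈ matchPositions R u w, ¬ (p < r ∧ r < q)) → Linked u.length p q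

/-- The blocks of linked matches over `A` that the collapse map, which keeps only the first and the
last letter, sends to the word `j i`. -/
def CollapsesTo (R : Word → Word → Prop) (u : Word) (A : Set ℕ+) (j i : ℕ+) :=
  {w : Word // (∀ a ∈ w, a ∈ A) ∧ w.head? = some j ∧ w.getLast? = some i ∧ IsLinkedBlock R u w}

/-- The weight of the descent `j i`: a block `w` with `m` matches that collapses to `j i`
contributes `(-x)^m` times `t` and `z_a` for each letter `a` that has been removed. -/
noncomputable def wt (R : Word → Word → Prop) (u : Word) (A : Set ℕ+) (j i : ℕ+) : PS :=
  ∑' w : CollapsesTo R u A j i,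
    (-x) ^ mch R u w.1 * t ^ (w.1.length - 2) * zWord w.1.tail.dropLast

/-- For `S = {j_1 < ⋯ < j_k}` the product
`z_{j_1} ⋯ z_{j_k} ∏_{i=1}^{k-1} (wt(j_{i+1} j_i) + x - 1)`. -/
noncomputable def DXTZ (R : Word → Word → Prop) (u : Word) (A : Set ℕ+) (S : Finset ℕ+) : PS :=
  (∏ j ∈ S, z j) *
    ((S.sort.zip S.sort.tail).map fun p => wt R u A p.2 p.1 + x - 1).prod

/-- The subsets of `A` with `n` elements. -/
def SubsetOfCard (A : Set ℕ+) (n : ℕ) := {S : Finset ℕ+ // S.card = n ∧ (S : Set ℕ+) ⊆ A}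

/-- `∑_{n ≥ 1} t^n ∑_{S ⊆ A, |S| = n} DXTZ(S)`; the terms with `n > |A|` vanish. -/
noncomputable def setSum (R : Word → Word → Prop) (u : Word) (A : Set ℕ+) : PS :=
  ∑' n : ℕ, t ^ (n + 1) * ∑' S : SubsetOfCard A (n + 1), DXTZ R u A S.1

/-! ## All the infinite sums above converge -/

theorem summable_of_finite {ι : Type*} (f : ι → PS)
    (h : ∀ m, {i | MvPowerSeries.coeff m (f i) ≠ 0}.Finite) : Summable f := by
  rw [MvPowerSeries.WithPiTopology.summable_iff_summable_coeff]
  exact fun m => summable_of_hasFiniteSupport (h m)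

theorem le_of_coeff_ne {s : Var} {n : ℕ} {f : PS} (hd : MvPowerSeries.X s ^ n ∣ f)
    {m : Var →₀ ℕ} (h : MvPowerSeries.coeff m f ≠ 0) : n ≤ m s := by
  by_contra hlt
  exact h (MvPowerSeries.X_pow_dvd_iff.mp hd m (not_le.mp hlt))

theorem z_pow_dvd_zWord (w : Word) (a : ℕ+) : z a ^ w.count a ∣ zWord w := by
  have h : (List.replicate (w.count a) a).Sublist w := List.replicate_sublist_iff.mpr le_rfl
  simpa [zWord] using (h.map z).prod_dvd_prod

theorem finite_words (m : Var →₀ ℕ) :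
    {w : Word | ∀ a, w.count a ≤ m (Var.z a)}.Finite := by
  have hinj : Function.Injective Var.z := fun a b h => by cases h; rfl
  let M : Multiset ℕ+ := Finsupp.toMultiset (m.comapDomain Var.z hinj.injOn)
  have hfin : (Set.Iic M).Finite := Set.finite_Iic M
  refine (hfin.biUnion (t := fun s => {w : Word | (w : Multiset ℕ+) = s}) ?_).subset ?_
  · intro s _
    refine (Multiset.lists s).finite_toSet.subset ?_
    intro w hw
    have hw' : (w : Multiset ℕ+) = s := hw
    simp [← hw']
  · intro w hw
    refine Set.mem_biUnion (x := (w : Multiset ℕ+)) ?_ rfl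
    refine Set.mem_Iic.mpr (Multiset.le_iff_count.mpr fun a => ?_)
    simpa [M] using hw a

theorem summable_avoidSum (R : Word → Word → Prop) (u : Word) (A : Set ℕ+) (n : ℕ) :
    Summable fun w : Avoiding R u A n => x ^ (des w.1 + 1) * zWord w.1 := by
  refine summable_of_finite _ fun m => ?_
  refine ((finite_words m).preimage (f := Subtype.val) Subtype.val_injective.injOn).subset ?_
  intro w hw a
  exact le_of_coeff_ne ((z_pow_dvd_zWord w.1 a).mul_left _) hw

theorem summable_t_pow (f : ℕ → PS) : Summable fun n => t ^ (n + 1) * f n := by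
  refine summable_of_finite _ fun m => (Set.finite_Iio (m Var.t)).subset ?_
  intro n hn
  exact le_of_coeff_ne (Dvd.intro _ rfl : t ^ (n + 1) ∣ _) hn

theorem summable_wt (R : Word → Word → Prop) (u : Word) (A : Set ℕ+) (j i : ℕ+) :
    Summable fun w : CollapsesTo R u A j i =>
      (-x) ^ mch R u w.1 * t ^ (w.1.length - 2) * zWord w.1.tail.dropLast := by
  refine summable_of_finite _ fun m => ?_
  refine (((finite_words m).image fun v => j :: (v ++ [i])).union
    (Set.finite_singleton [j])).preimage Subtype.val_injective.injOn |>.subset ?_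
  rintro ⟨w, hw⟩ hne
  have hc : ∀ a, w.tail.dropLast.count a ≤ m (Var.z a) := fun a =>
    le_of_coeff_ne ((z_pow_dvd_zWord w.tail.dropLast a).mul_left _) hne
  obtain ⟨-, hh, hl, -⟩ := hw
  simp only [Set.mem_preimage, Set.mem_union, Set.mem_image, Set.mem_singleton_iff]
  obtain ⟨v, rfl⟩ := List.head?_eq_some_iff.mp hh
  rcases List.eq_nil_or_concat v with rfl | ⟨v', b, rfl⟩
  · exact Or.inr rfl
  · refine Or.inl ⟨v', ?_, ?_⟩
    · simpa using hc
    · rw [List.concat_eq_append, ← List.cons_append, List.getLast?_concat] at hl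
      simp [Option.some.inj hl]

theorem summable_DXTZ (R : Word → Word → Prop) (u : Word) (A : Set ℕ+) (n : ℕ) :
    Summable fun S : SubsetOfCard A n => DXTZ R u A S.1 := by
  classical
  have hinj : Function.Injective Var.z := fun a b h => by cases h; rfl
  refine summable_of_finite _ fun m => ?_
  refine ((m.comapDomain Var.z hinj.injOn).support.powerset.finite_toSet.preimage
    (f := Subtype.val) Subtype.val_injective.injOn).subset ?_
  intro S hS
  simp only [Set.mem_preimage, Finset.coe_powerset, Set.mem_powerset_iff]
  intro a ha
  have hd : z a ^ 1 ∣ DXTZ R u A S.1 := by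
    rw [pow_one]
    exact (Finset.dvd_prod_of_mem z ha).mul_right _
  have := le_of_coeff_ne hd hS
  simp
  omega

end PatWord

open PatWord

namespace PatWord

/-! ## Chains of linked matches -/

/-! Give a word without matches the weight `x^des`, and let `F_b` be the generating function of the
nonempty words without matches that begin with `b`. Everything rests on the recursion `F_b = t z_b
(1 + ∑_c F_c + ∑_{c<b} (wt(bc) + x - 1) F_c)`, which is `firstGF_eq`.

It comes from an identity for single words, `avoidWt_cons_cons`: the weight of `b c v` is the step
weight of `b c` times the weight of `c v`, plus a signed sum over the linked blocks that are
prefixes, each multiplied by the weight of the suffix starting at the block's last letter. Without a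
match at the first letter there are no such blocks. With one, the left side is zero and the signed
sum must cancel the step term; this is `OneDescent.chainSum_eq`. The cancellation uses `des u = 1`:
every match has one descent, at a fixed offset, so overlapping matches share no descent and the
overlap is weakly increasing. The same fact, combined with `u_1 > u_j`, makes the last letter of any
linked block smaller than its first, so that `wt(bc)` only matters for `c < b`.

Sorting finite sets by their maximum gives series `G_b` with `∑_b G_b = setSum` and `G_b = t z_b (1
+ ∑_{c<b} (wt(bc) + x - 1) G_c)`. This is the recursion of `F_b` with `1 + ∑_c F_c` replaced by `1`.
Hence `F_b = G_b (1 + F)` with `F = ∑_c F_c`, by induction on `b`. Summing, `F = G (1 + F)` with `G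
= setSum`, and `avoidGF = 1 + x F` gives the quotient. Both kinds of matches are treated at once:
only order isomorphism with `u` matters. -/

/-- Any two consecutive elements of `M` between `s` and `e` are linked. -/
def LinkedChain (ℓ : ℕ) (M : Finset ℕ) (s e : ℕ) : Prop :=
  ∀ p ∈ M, ∀ q ∈ M, s ≤ p → q ≤ e → p < q → (∀ r ∈ M, ¬ (p < r ∧ r < q)) → Linked ℓ p q

/-- The positions in `M` are starting points of occurrences of a pattern of length `ℓ` whose only
descent is at position `d`; the set of descents is `D`. -/
structure OneDescent (ℓ d : ℕ) (M : Finset ℕ) (D : ℕ → Prop) : Prop where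
  lt : d + 1 < ℓ
  iff : ∀ p ∈ M, ∀ k, k + 1 < ℓ → (D (p + k) ↔ k = d)

/-- If `q ≤ p + d`, the descent of the occurrence at `p` would fall in the one at `q` at an offset
smaller than `d`. -/
theorem OneDescent.lt_of_mem {ℓ d : ℕ} {M : Finset ℕ} {D : ℕ → Prop} (h : OneDescent ℓ d M D)
    {p q : ℕ} (hp : p ∈ M) (hq : q ∈ M) (hpq : p < q) : p + d < q := by
  by_contra hle
  have hd := h.lt
  have h1 := (h.iff p hp d h.lt).2 rfl
  have h2 := h.iff q hq (p + d - q) (by omega)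
  rw [show q + (p + d - q) = p + d by omega] at h2
  have := h2.1 h1
  omega

/-- Mirror image of the previous bound: the descent of the later occurrence lies past every step of
the earlier one. -/
theorem OneDescent.le_of_mem {ℓ d : ℕ} {M : Finset ℕ} {D : ℕ → Prop} (h : OneDescent ℓ d M D)
    {p q : ℕ} (hp : p ∈ M) (hq : q ∈ M) (hpq : p < q) : p + ℓ ≤ q + d + 1 := by
  by_contra hlt
  have h1 := (h.iff q hq d h.lt).2 rfl
  have h2 := h.iff p hp (q + d - p) (by omega)
  rw [show p + (q + d - p) = q + d by omega] at h2
  have := h2.1 h1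
  omega

/-- The overlap lies after the only descent `p + d` of the earlier occurrence. -/
theorem OneDescent.not_descent {ℓ d : ℕ} {M : Finset ℕ} {D : ℕ → Prop} (h : OneDescent ℓ d M D)
    {p q : ℕ} (hp : p ∈ M) (hq : q ∈ M) (hpq : p < q) {k : ℕ} (hk : q ≤ k) (hk' : k + 1 < p + ℓ) :
    ¬ D k := by
  have h1 := h.lt_of_mem hp hq hpq
  have h2 := h.iff p hp (k - p) (by omega)
  rw [show p + (k - p) = k by omega] at h2
  rw [h2]
  omega

theorem exists_next {M : Finset ℕ} {s : ℕ} (h : ∃ q ∈ M, s < q) :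
    ∃ q ∈ M, s < q ∧ ∀ r ∈ M, s < r → q ≤ r := by
  classical
  have h' : ∃ q, q ∈ M ∧ s < q := h
  refine ⟨Nat.find h', (Nat.find_spec h').1, (Nat.find_spec h').2, fun r hr hsr => ?_⟩
  exact Nat.find_min' h' ⟨hr, hsr⟩

theorem linkedChain_self (ℓ : ℕ) (M : Finset ℕ) (s : ℕ) : LinkedChain ℓ M s s := by
  intro p _ q _ h1 h2 h3
  omega

/-- Peels the first link off a chain; all inductions on chains run through this. -/
theorem linkedChain_iff_next {ℓ : ℕ} {M : Finset ℕ} {s q e : ℕ} (hs : s ∈ M) (hq : q ∈ M)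
    (hsq : s < q) (hmin : ∀ r ∈ M, s < r → q ≤ r) (hqe : q ≤ e) :
    LinkedChain ℓ M s e ↔ Linked ℓ s q ∧ LinkedChain ℓ M q e := by
  constructor
  · intro h
    refine ⟨h s hs q hq le_rfl hqe hsq fun r hr hr' => ?_, fun p hp r hr h1 => ?_⟩
    · exact absurd (hmin r hr hr'.1) (by omega)
    · exact h p hp r hr (by omega)
  · rintro ⟨h1, h2⟩ p hp r hr h3 h4 h5 h6
    rcases Nat.eq_or_lt_of_le h3 with rfl | h3
    · have h7 := hmin r hr h5
      have : r = q := by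
        by_contra hne
        exact h6 q hq ⟨hsq, by omega⟩
      subst this
      exact h1
    · exact h2 p hp r hr (hmin p hp h3) h4 h5 h6

/-- If `q` follows `s`, the overlap rises weakly from `q` to the end of the match at `s`, so `f q ≤
f (s + ℓ - 1) < f s`. Iterate along the chain. -/
theorem OneDescent.last_lt_first {ℓ d : ℕ} {M : Finset ℕ} {f : ℕ → ℕ+}
    (h : OneDescent ℓ d M fun k => f (k + 1) < f k) (hf : ∀ p ∈ M, f (p + ℓ - 1) < f p) (e : ℕ)
    (he : e ∈ M) (s : ℕ) (hs : s ∈ M) (hse : s ≤ e) (hc : LinkedChain ℓ M s e) :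
    f (e + ℓ - 1) < f s := by
  induction hn : e - s using Nat.strong_induction_on generalizing s with
  | _ n ih =>
    rcases Nat.eq_or_lt_of_le hse with rfl | hlt
    · exact hf s hs
    · obtain ⟨q, hq, hsq, hmin⟩ := exists_next ⟨e, he, hlt⟩
      have hqe := hmin e he hlt
      obtain ⟨hl, hc'⟩ := (linkedChain_iff_next hs hq hsq hmin hqe).1 hc
      have h1 := ih (e - q) (by omega) q hq hqe hc' rfl
      have h2 : ∀ k, q + k < s + ℓ → f q ≤ f (q + k) := by
        intro k
        induction k with
        | zero => intro; exact le_rfl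
        | succ k ihk =>
          intro hk
          exact (ihk (by omega)).trans
            (not_lt.1 (h.not_descent hs hq hsq (k := q + k) (by omega) (by omega)))
      have h3 := h2 (s + ℓ - 1 - q) (by have := hl.2; omega)
      rw [show q + (s + ℓ - 1 - q) = s + ℓ - 1 by have := hl.2; omega] at h3
      exact h1.trans (h3.trans_lt (hf s hs))

open Classical in
/-- The signed sum over the chains of linked matches that start at `s`. -/
noncomputable def chainSum (ℓ : ℕ) (M : Finset ℕ) (α : ℕ → PS) (s : ℕ) : PS :=
  ∑ e ∈ M with s ≤ e ∧ LinkedChain ℓ M s e,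
    (-x) ^ (M.filter fun p => s ≤ p ∧ p ≤ e).card * α (e + ℓ - 1)

/-- A chain from `s` is either `s` alone or a chain from `q` with `s` prepended, which costs one
more factor `-x`. -/
theorem chainSum_eq_of_linked {ℓ : ℕ} {M : Finset ℕ} (α : ℕ → PS) {s q : ℕ} (hs : s ∈ M)
    (hq : q ∈ M) (hsq : s < q) (hmin : ∀ r ∈ M, s < r → q ≤ r) (hl : Linked ℓ s q) :
    chainSum ℓ M α s = -x * α (s + ℓ - 1) + -x * chainSum ℓ M α q := by
  classical
  have hset : (M.filter fun e => s ≤ e ∧ LinkedChain ℓ M s e) =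
      insert s (M.filter fun e => q ≤ e ∧ LinkedChain ℓ M q e) := by
    ext e
    simp only [Finset.mem_filter, Finset.mem_insert]
    constructor
    · rintro ⟨he, hse, hc⟩
      rcases Nat.eq_or_lt_of_le hse with rfl | hlt
      · exact Or.inl rfl
      · have hqe := hmin e he hlt
        exact Or.inr ⟨he, hqe, ((linkedChain_iff_next hs hq hsq hmin hqe).1 hc).2⟩
    · rintro (rfl | ⟨he, hqe, hc⟩)
      · exact ⟨hs, le_rfl, linkedChain_self _ _ _⟩
      · exact ⟨he, by omega, (linkedChain_iff_next hs hq hsq hmin hqe).2 ⟨hl, hc⟩⟩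
  unfold chainSum
  rw [hset, Finset.sum_insert (by simp; omega), Finset.mul_sum]
  congr 1
  · rw [show (M.filter fun p => s ≤ p ∧ p ≤ s) = {s} by
      ext p
      simp only [Finset.mem_filter, Finset.mem_singleton]
      constructor
      · rintro ⟨_, h⟩
        omega
      · rintro rfl
        exact ⟨hs, le_rfl, le_rfl⟩]
    simp
  · refine Finset.sum_congr rfl fun e he => ?_
    have hqe := (Finset.mem_filter.1 he).2.1
    rw [show (M.filter fun p => s ≤ p ∧ p ≤ e) = insert s (M.filter fun p => q ≤ p ∧ p ≤ e) by
      ext p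
      simp only [Finset.mem_filter, Finset.mem_insert]
      constructor
      · rintro ⟨hp, h1, h2⟩
        rcases Nat.eq_or_lt_of_le h1 with rfl | hlt
        · exact Or.inl rfl
        · exact Or.inr ⟨hp, hmin p hp hlt, h2⟩
      · rintro (rfl | ⟨hp, h1, h2⟩)
        · exact ⟨hs, le_rfl, by omega⟩
        · exact ⟨hp, by omega, h2⟩]
    rw [Finset.card_insert_of_notMem (by simp; omega)]
    ring

theorem chainSum_eq_of_not_linked {ℓ : ℕ} {M : Finset ℕ} (α : ℕ → PS) {s : ℕ} (hs : s ∈ M)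
    (hl : ∀ q ∈ M, s < q → s + ℓ ≤ q + 1) : chainSum ℓ M α s = -x * α (s + ℓ - 1) := by
  classical
  have hset : (M.filter fun e => s ≤ e ∧ LinkedChain ℓ M s e) = {s} := by
    ext e
    simp only [Finset.mem_filter, Finset.mem_singleton]
    constructor
    · rintro ⟨he, hse, hc⟩
      rcases Nat.eq_or_lt_of_le hse with rfl | hlt
      · rfl
      · obtain ⟨q, hq, hsq, hmin⟩ := exists_next ⟨e, he, hlt⟩
        have h1 := ((linkedChain_iff_next hs hq hsq hmin (hmin e he hlt)).1 hc).1.2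
        have h2 := hl q hq hsq
        omega
    · rintro rfl
      exact ⟨hs, le_rfl, linkedChain_self _ _ _⟩
  unfold chainSum
  rw [hset, Finset.sum_singleton, show (M.filter fun p => s ≤ p ∧ p ≤ s) = {s} by
    ext p
    simp only [Finset.mem_filter, Finset.mem_singleton]
    constructor
    · rintro ⟨_, h⟩
      omega
    · rintro rfl
      exact ⟨hs, le_rfl, le_rfl⟩]
  simp

open Classical in
/-- The weight of a step from one letter to the next: `x` for a descent, `1` otherwise. -/
noncomputable def stepWt (P : Prop) : PS := if P then x else 1

/-- Letters at which no occurrence starts can be stripped one at a time, each leaving its step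
weight. The position `s` itself may lie in `M`, since `hα` is only applied after it. -/
theorem prod_stepWt_eq {M : Finset ℕ} {D : ℕ → Prop} {α : ℕ → PS} {n : ℕ}
    (hα : ∀ i, i + 1 < n → i ∉ M → α i = stepWt (D i) * α (i + 1)) (s k : ℕ) (hk : s + k + 1 < n)
    (hM : ∀ p ∈ M, s < p → s + k + 1 ≤ p) :
    stepWt (D s) * α (s + 1) =
      (∏ i ∈ Finset.range (k + 1), stepWt (D (s + i))) * α (s + (k + 1)) := by
  induction k with
  | zero => simp
  | succ k ih =>
    rw [ih (by omega) fun p hp hsp => by have := hM p hp hsp; omega, Finset.prod_range_succ _ (k + 1),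
      hα (s + (k + 1)) (by omega) fun h => by have := hM _ h (by omega); omega]
    ring_nf

/-- The key cancellation, with `α i` standing for the weight of the suffix at `i`. Without a linked
successor, one match survives and its steps multiply to `x`. With one, `α (s + 1) = 0`, and the
chain `s` cancels against all longer chains. -/
theorem OneDescent.chainSum_eq {ℓ d : ℕ} {M : Finset ℕ} {D : ℕ → Prop} (h : OneDescent ℓ d M D)
    {α : ℕ → PS} {n : ℕ} (hn : ∀ p ∈ M, p + ℓ ≤ n)
    (hα : ∀ i, i + 1 < n → i ∉ M → α i = stepWt (D i) * α (i + 1))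
    (hα0 : ∀ i, ∀ p ∈ M, i ≤ p → α i = 0) (s : ℕ) (hs : s ∈ M) :
    chainSum ℓ M α s = -(stepWt (D s) * α (s + 1)) := by
  induction hm : n - s using Nat.strong_induction_on generalizing s with
  | _ m ih =>
    have hd := h.lt
    have hsn := hn s hs
    by_cases hl : ∀ q ∈ M, s < q → s + ℓ ≤ q + 1
    · rw [chainSum_eq_of_not_linked α hs hl, prod_stepWt_eq hα s (ℓ - 2) (by omega)
        fun p hp hsp => by have := hl p hp hsp; omega]
      -- Among the `ℓ - 1` steps of the match only the one at offset `d` is a descent, so the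
      -- product is `x`.
      rw [Finset.prod_eq_single d]
      · rw [stepWt, if_pos ((h.iff s hs d hd).2 rfl),
          show s + (ℓ - 2 + 1) = s + ℓ - 1 by omega]
        ring
      · intro k hk hne
        rw [stepWt, if_neg]
        rw [h.iff s hs k (by simp at hk; omega)]
        exact hne
      · intro hk
        simp at hk
        omega
    · push Not at hl
      obtain ⟨q', hq', hsq', hlt⟩ := hl
      obtain ⟨q, hq, hsq, hmin⟩ := exists_next ⟨q', hq', hsq'⟩
      have hqq' := hmin q' hq' hsq'
      have hqn := hn q hq
      have hle := h.le_of_mem hs hq hsq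
      -- The suffix at `s + 1` still contains the occurrence at `q`, so the right side vanishes.
      rw [chainSum_eq_of_linked α hs hq hsq hmin ⟨hsq, by omega⟩, ih (n - q) (by omega) q hq rfl,
        hα0 (s + 1) q hq hsq]
      -- A third occurrence `p > q` satisfies `p > q + d ≥ s + ℓ - 1`, so none starts inside the
      -- overlap.
      rw [prod_stepWt_eq hα q (s + ℓ - 2 - q) (by omega) fun p hp hqp => by
        have := h.lt_of_mem hq hp hqp; omega]
      rw [Finset.prod_eq_one]
      · rw [show q + (s + ℓ - 2 - q + 1) = s + ℓ - 1 by omega]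
        ring
      · intro k hk
        simp at hk
        rw [stepWt, if_neg (h.not_descent hs hq hsq (by omega) (by omega))]

/-! ## Matches and descents in words -/

/-- Every word with `R u v` is order isomorphic to `u`. -/
def OrderIsoRel (R : Word → Word → Prop) (u : Word) : Prop :=
  ∀ v, R u v → v.length = u.length ∧
    ∀ i k, i < u.length → k < u.length → (v.getD i 1 < v.getD k 1 ↔ u.getD i 1 < u.getD k 1)

theorem orderIsoRel_isExactMatch (u : Word) : OrderIsoRel IsExactMatch u := by
  rintro v rfl
  exact ⟨rfl, fun _ _ _ _ => Iff.rfl⟩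

/-- The rank is monotone in the letter, and strictly so past `a` because `a` itself occurs in `v`.
-/
theorem red_letter_lt_iff {v : Word} {a b : ℕ+} (ha : a ∈ v) :
    (v.toFinset.filter fun c => c < a).card < (v.toFinset.filter fun c => c < b).card ↔ a < b := by
  constructor
  · intro h
    by_contra hle
    refine absurd (Finset.card_le_card ?_) (not_le.2 h)
    intro c hc
    rw [Finset.mem_filter] at hc ⊢
    exact ⟨hc.1, hc.2.trans_le (not_lt.1 hle)⟩
  · intro h
    refine Finset.card_lt_card ⟨fun c hc => ?_, fun hsub => ?_⟩
    · rw [Finset.mem_filter] at hc ⊢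
      exact ⟨hc.1, hc.2.trans h⟩
    · have := hsub (Finset.mem_filter.2 ⟨List.mem_toFinset.2 ha, h⟩)
      simp at this

theorem orderIsoRel_isMatch (u : Word) : OrderIsoRel IsMatch u := by
  rintro v rfl
  have hlen : (red v).length = v.length := by simp [red]
  refine ⟨hlen.symm, fun i k hi hk => ?_⟩
  have hi' : i < v.length := hlen ▸ hi
  have hk' : k < v.length := hlen ▸ hk
  rw [List.getD_eq_getElem _ _ hi, List.getD_eq_getElem _ _ hk, List.getD_eq_getElem _ _ hi',
    List.getD_eq_getElem _ _ hk']
  simp only [red, List.getElem_map]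
  rw [Nat.succPNat_lt_succPNat, red_letter_lt_iff (List.getElem_mem hi')]

theorem mem_matchPositions {R : Word → Word → Prop} {u w : Word} {p : ℕ} :
    p ∈ matchPositions R u w ↔ p + u.length ≤ w.length ∧ R u ((w.drop p).take u.length) := by
  simp only [matchPositions, Finset.mem_filter, Finset.mem_range]
  exact and_congr_left fun _ => by omega

theorem mem_matchPositions_drop {R : Word → Word → Prop} {u w : Word} {i p : ℕ}
    (hi : i ≤ w.length) :
    p ∈ matchPositions R u (w.drop i) ↔ i + p ∈ matchPositions R u w := by
  rw [mem_matchPositions, mem_matchPositions, List.drop_drop, List.length_drop]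
  exact and_congr_left fun _ => by omega

theorem mem_matchPositions_take {R : Word → Word → Prop} {u w : Word} {n p : ℕ}
    (hn : n ≤ w.length) :
    p ∈ matchPositions R u (w.take n) ↔ p + u.length ≤ n ∧ p ∈ matchPositions R u w := by
  rw [mem_matchPositions, mem_matchPositions, List.length_take, min_eq_left hn]
  by_cases h : p + u.length ≤ n
  · rw [List.drop_take, List.take_take, min_eq_left (by omega : u.length ≤ n - p)]
    simp [h, h.trans hn]
  · simp [h]

theorem des_cons_cons (b c : ℕ+) (v : Word) :
    des (b :: c :: v) = (if c < b then 1 else 0) + des (c :: v) := by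
  simp [des, List.countP_cons, add_comm]

theorem getD_cons_lt_of_des_eq_zero (w : Word) (h : des w = 0) (k : ℕ) (hk : k + 1 < w.length) :
    ¬ w.getD (k + 1) 1 < w.getD k 1 := by
  induction w generalizing k with
  | nil => simp at hk
  | cons b v ih =>
    cases v with
    | nil => simp at hk
    | cons c v =>
      rw [des_cons_cons] at h
      cases k with
      | zero =>
        intro hlt
        simp at hlt
        simp [hlt] at h
      | succ k => exact ih (by omega) k (by simpa using hk)

theorem exists_descent_of_des_eq_one (w : Word) (h : des w = 1) :
    ∃ d, d + 1 < w.length ∧ ∀ k, k + 1 < w.length → (w.getD (k + 1) 1 < w.getD k 1 ↔ k = d) := by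
  induction w with
  | nil => simp [des] at h
  | cons b v ih =>
    cases v with
    | nil => simp [des] at h
    | cons c v =>
      rw [des_cons_cons] at h
      by_cases hcb : c < b
      · rw [if_pos hcb] at h
        refine ⟨0, by simp, fun k hk => ?_⟩
        cases k with
        | zero => simpa using hcb
        | succ k =>
          have := getD_cons_lt_of_des_eq_zero (c :: v) (by omega) k (by simpa using hk)
          simpa using this
      · rw [if_neg hcb, zero_add] at h
        obtain ⟨d, hd, hiff⟩ := ih h
        refine ⟨d + 1, by simpa using hd, fun k hk => ?_⟩
        cases k with
        | zero => simpa using hcb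
        | succ k =>
          have := hiff k (by simpa using hk)
          simpa using this

theorem getD_take_drop {w : Word} {p n k : ℕ} (hk : k < n) :
    ((w.drop p).take n).getD k 1 = w.getD (p + k) 1 := by
  simp only [List.getD_eq_getElem?_getD]
  rw [List.getElem?_take_of_lt hk, List.getElem?_drop]

/-- The pattern has a single descent, and its first letter is larger than its last letter. -/
structure GoodPattern (u : Word) : Prop where
  des_eq : des u = 1
  last_lt : u.getD (u.length - 1) 1 < u.getD 0 1

theorem GoodPattern.two_le {u : Word} (h : GoodPattern u) : 2 ≤ u.length := by
  obtain ⟨d, hd, _⟩ := exists_descent_of_des_eq_one u h.des_eq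
  omega

theorem GoodPattern.exists_oneDescent {R : Word → Word → Prop} {u : Word} (h : GoodPattern u)
    (hR : OrderIsoRel R u) (w : Word) : ∃ d, OneDescent u.length d (matchPositions R u w)
      fun k => w.getD (k + 1) 1 < w.getD k 1 := by
  obtain ⟨d, hd, hiff⟩ := exists_descent_of_des_eq_one u h.des_eq
  refine ⟨d, hd, fun p hp k hk => ?_⟩
  have h1 := (hR _ (mem_matchPositions.1 hp).2).2 (k + 1) k hk (by omega)
  rw [getD_take_drop hk, getD_take_drop (by omega)] at h1
  rw [← hiff k hk, ← h1, add_assoc]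

theorem GoodPattern.getD_last_lt {R : Word → Word → Prop} {u : Word} (h : GoodPattern u)
    (hR : OrderIsoRel R u) (w : Word) (p : ℕ) (hp : p ∈ matchPositions R u w) :
    w.getD (p + u.length - 1) 1 < w.getD p 1 := by
  have h2 := h.two_le
  have h1 := (hR _ (mem_matchPositions.1 hp).2).2 (u.length - 1) 0 (by omega) (by omega)
  rw [getD_take_drop (by omega), getD_take_drop (by omega)] at h1
  have := h1.2 h.last_lt
  rwa [add_zero, ← Nat.add_sub_assoc (by omega)] at this

/-- The matches in the prefix of length `e + |u|` are the matches of `w` that start at or before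
`e`. -/
theorem isLinkedBlock_take_iff {R : Word → Word → Prop} {u w : Word} {e : ℕ}
    (he : e + u.length ≤ w.length) :
    IsLinkedBlock R u (w.take (e + u.length)) ↔ 0 ∈ matchPositions R u w ∧
      e ∈ matchPositions R u w ∧ LinkedChain u.length (matchPositions R u w) 0 e := by
  have hlen : (w.take (e + u.length)).length = e + u.length := by simp [he]
  have hmem : ∀ p, p ∈ matchPositions R u (w.take (e + u.length)) ↔
      p ≤ e ∧ p ∈ matchPositions R u w := fun p => by
    rw [mem_matchPositions_take he, Nat.add_le_add_iff_right]
  unfold IsLinkedBlock LinkedChain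
  rw [hlen, Nat.add_sub_cancel]
  simp only [hmem]
  constructor
  · rintro ⟨-, ⟨-, h0⟩, ⟨-, h1⟩, h⟩
    exact ⟨h0, h1, fun p hp q hq _ hqe hpq hr => h p ⟨by omega, hp⟩ q ⟨hqe, hq⟩ hpq
      fun r hr' => hr r hr'.2⟩
  · rintro ⟨h0, h1, h⟩
    exact ⟨by omega, ⟨by omega, h0⟩, ⟨le_rfl, h1⟩, fun p hp q hq hpq hr =>
      h p hp.2 q hq.2 (by omega) hq.1 hpq fun r hr' hr2 => hr r ⟨by omega, hr'⟩ hr2⟩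

theorem isLinkedBlock_iff {R : Word → Word → Prop} {u w : Word} (h : u.length ≤ w.length) :
    IsLinkedBlock R u w ↔ 0 ∈ matchPositions R u w ∧
      w.length - u.length ∈ matchPositions R u w ∧
      LinkedChain u.length (matchPositions R u w) 0 (w.length - u.length) := by
  have := isLinkedBlock_take_iff (R := R) (u := u) (w := w) (e := w.length - u.length) (by omega)
  rwa [Nat.sub_add_cancel h, List.take_length] at this

theorem IsLinkedBlock.last_lt_first {R : Word → Word → Prop} {u w : Word} (h : GoodPattern u)
    (hR : OrderIsoRel R u) (hw : IsLinkedBlock R u w) :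
    w.getD (w.length - 1) 1 < w.getD 0 1 := by
  obtain ⟨h0, h1, hc⟩ := (isLinkedBlock_iff hw.1).1 hw
  obtain ⟨d, hd⟩ := h.exists_oneDescent hR w
  have := OneDescent.last_lt_first (f := fun k => w.getD k 1) hd (h.getD_last_lt hR w) _ h1 0 h0 (Nat.zero_le _) hc
  rwa [Nat.sub_add_cancel hw.1] at this

/-! ### Weights of single words and their decomposition -/

open Classical in
/-- `x^{des(w)}` if `w` has no matches, and `0` otherwise. -/
noncomputable def avoidWt (R : Word → Word → Prop) (u w : Word) : PS :=
  if mch R u w = 0 then x ^ des w else 0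

open Classical in
/-- `(-x)^m` if `w` is a linked block with `m` matches, and `0` otherwise. -/
noncomputable def blockWt (R : Word → Word → Prop) (u w : Word) : PS :=
  if IsLinkedBlock R u w then (-x) ^ mch R u w else 0

theorem mch_eq_zero_iff {R : Word → Word → Prop} {u w : Word} :
    mch R u w = 0 ↔ ∀ p, p ∉ matchPositions R u w := by
  rw [mch, Finset.card_eq_zero, Finset.eq_empty_iff_forall_notMem]

theorem avoidWt_drop_eq_zero {R : Word → Word → Prop} {u w : Word} {i p : ℕ}
    (hp : p ∈ matchPositions R u w) (hip : i ≤ p) : avoidWt R u (w.drop i) = 0 := by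
  have := (mem_matchPositions.1 hp).1
  refine if_neg fun h => mch_eq_zero_iff.1 h (p - i) ?_
  rw [mem_matchPositions_drop (by omega), Nat.add_sub_cancel' hip]
  exact hp

theorem avoidWt_drop_eq {R : Word → Word → Prop} {u w : Word} {i : ℕ} (hi : i + 1 < w.length)
    (hM : i ∉ matchPositions R u w) :
    avoidWt R u (w.drop i) =
      stepWt (w.getD (i + 1) 1 < w.getD i 1) * avoidWt R u (w.drop (i + 1)) := by
  have hmch : mch R u (w.drop i) = 0 ↔ mch R u (w.drop (i + 1)) = 0 := by
    rw [mch_eq_zero_iff, mch_eq_zero_iff]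
    simp only [mem_matchPositions_drop (w := w) (i := i) (by omega),
      mem_matchPositions_drop (w := w) (i := i + 1) (by omega)]
    constructor
    · intro h p
      rw [add_assoc]
      exact h _
    · intro h p
      cases p with
      | zero => exact hM
      | succ p =>
        rw [add_comm p, ← add_assoc]
        exact h p
  have hdes : (x : PS) ^ des (w.drop i) =
      stepWt (w.getD (i + 1) 1 < w.getD i 1) * x ^ des (w.drop (i + 1)) := by
    rw [List.drop_eq_getElem_cons (show i < w.length by omega), List.drop_eq_getElem_cons hi,
      des_cons_cons, List.getD_eq_getElem _ _ hi,
      List.getD_eq_getElem _ _ (show i < w.length by omega), pow_add, stepWt]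
    split_ifs <;> simp
  unfold avoidWt
  by_cases h : mch R u (w.drop i) = 0
  · rw [if_pos h, if_pos (hmch.1 h), hdes]
  · rw [if_neg h, if_neg (mt hmch.2 h), mul_zero]

theorem blockWt_eq_zero {R : Word → Word → Prop} {u w : Word} (h : w.length < u.length) :
    blockWt R u w = 0 :=
  if_neg fun hw => absurd hw.1 (by omega)

theorem blockWt_take {R : Word → Word → Prop} {u w : Word} {e : ℕ}
    (he : e + u.length ≤ w.length) (h0 : 0 ∈ matchPositions R u w) [Decidable
      (e ∈ matchPositions R u w ∧ 0 ≤ e ∧ LinkedChain u.length (matchPositions R u w) 0 e)] :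
    blockWt R u (w.take (e + u.length)) =
      if e ∈ matchPositions R u w ∧ 0 ≤ e ∧ LinkedChain u.length (matchPositions R u w) 0 e then
        (-x) ^ ((matchPositions R u w).filter fun p => 0 ≤ p ∧ p ≤ e).card else 0 := by
  classical
  unfold blockWt
  refine if_congr ?_ ?_ rfl
  · rw [isLinkedBlock_take_iff he]
    simp [h0]
  · rw [mch]
    congr 2
    ext p
    rw [mem_matchPositions_take he, Nat.add_le_add_iff_right, Finset.mem_filter]
    simp [and_comm]

/-- The prefix of length `i + 2` and the suffix at `i + 1` share one letter, the last of the block.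
Prefixes shorter than `u` contribute nothing; the others are indexed by the start `e = i + 2 - |u|`
of their last match. -/
theorem sum_blockWt {R : Word → Word → Prop} {u w : Word} (hu : 2 ≤ u.length)
    (h0 : 0 ∈ matchPositions R u w) :
    ∑ i ∈ Finset.range (w.length - 1), blockWt R u (w.take (i + 2)) * avoidWt R u (w.drop (i + 1)) =
      chainSum u.length (matchPositions R u w) (fun i => avoidWt R u (w.drop i)) 0 := by
  classical
  have hle := (mem_matchPositions.1 h0).1
  have hsub : matchPositions R u w ⊆ Finset.range (w.length + 1 - u.length) := fun p hp => by
    have := (mem_matchPositions.1 hp).1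
    rw [Finset.mem_range]
    omega
  unfold chainSum
  rw [← Finset.inter_eq_right.2 hsub, ← Finset.filter_mem_eq_inter, Finset.filter_filter,
    Finset.sum_filter, Finset.filter_mem_eq_inter, Finset.inter_eq_right.2 hsub,
    show w.length - 1 = (u.length - 2) + (w.length + 1 - u.length) by omega,
    Finset.sum_range_add, Finset.sum_eq_zero, zero_add]
  · refine Finset.sum_congr rfl fun e he => ?_
    rw [Finset.mem_range] at he
    rw [show u.length - 2 + e + 2 = e + u.length by omega, blockWt_take (by omega) h0, ite_mul,
      zero_mul, show u.length - 2 + e + 1 = e + u.length - 1 by omega]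
  · intro i hi
    rw [Finset.mem_range] at hi
    rw [blockWt_eq_zero, zero_mul]
    rw [List.length_take]
    omega

/-- Decomposition of a word according to the linked blocks that start at its first letter. -/
theorem avoidWt_cons_cons {R : Word → Word → Prop} {u : Word} (h : GoodPattern u)
    (hR : OrderIsoRel R u) (b c : ℕ+) (v : Word) :
    avoidWt R u (b :: c :: v) = stepWt (c < b) * avoidWt R u (c :: v) +
      ∑ i ∈ Finset.range (v.length + 1),
        blockWt R u (b :: (c :: v).take (i + 1)) * avoidWt R u ((c :: v).drop i) := by
  set w := b :: c :: v with hw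
  by_cases h0 : 0 ∈ matchPositions R u w
  · obtain ⟨d, hd⟩ := h.exists_oneDescent hR w
    have h1 := hd.chainSum_eq (α := fun i => avoidWt R u (w.drop i)) (n := w.length)
      (fun p hp => (mem_matchPositions.1 hp).1) (fun i hi => avoidWt_drop_eq hi)
      (fun i p hp hip => avoidWt_drop_eq_zero hp hip) 0 h0
    rw [← sum_blockWt h.two_le h0] at h1
    have h2 := avoidWt_drop_eq_zero h0 le_rfl
    simp only [List.drop_zero] at h2
    rw [h2]
    simp [hw] at h1 ⊢
    rw [h1]
    ring
  · have h1 := avoidWt_drop_eq (R := R) (u := u) (w := w) (i := 0) (by simp [hw]) h0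
    rw [Finset.sum_eq_zero, add_zero]
    · simpa [hw] using h1
    · intro i hi
      rw [Finset.mem_range] at hi
      rw [blockWt, if_neg, zero_mul]
      intro hb
      have : b :: (c :: v).take (i + 1) = w.take (i + 2) := by simp [hw]
      rw [this] at hb
      have := hb.2.1
      rw [mem_matchPositions_take (by simp [hw]; omega)] at this
      exact h0 this.2

theorem avoidWt_singleton {R : Word → Word → Prop} {u : Word} (hu : 2 ≤ u.length) (b : ℕ+) :
    avoidWt R u [b] = 1 := by
  rw [avoidWt, if_pos]
  · simp [des]
  · rw [mch_eq_zero_iff]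
    intro p hp
    have := (mem_matchPositions.1 hp).1
    simp at this
    omega

/-! ## Sums over words and sets -/

/-- A fixed monomial bounds the multiplicity of every letter, which leaves finitely many words. -/
theorem summable_of_zWord_dvd {ι : Type*} {f : ι → PS} {g : ι → Word}
    (hg : ∀ w, (g ⁻¹' {w}).Finite) (h : ∀ i, zWord (g i) ∣ f i) : Summable f := by
  refine summable_of_finite _ fun m => ?_
  refine ((finite_words m).preimage' fun w _ => hg w).subset ?_
  intro i hi a
  exact le_of_coeff_ne ((z_pow_dvd_zWord (g i) a).trans (h i)) hi

theorem summable_of_zWord_dvd_of_injective {ι : Type*} {f : ι → PS} {g : ι → Word}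
    (hg : Function.Injective g) (h : ∀ i, zWord (g i) ∣ f i) : Summable f :=
  summable_of_zWord_dvd (fun w => (Set.finite_singleton w).preimage hg.injOn) h

theorem finite_of_summable {ι : Type*} {f : ι → PS} (hf : Summable f) (m : Var →₀ ℕ) :
    {i | MvPowerSeries.coeff m (f i) ≠ 0}.Finite :=
  (MvPowerSeries.WithPiTopology.summable_iff_summable_coeff.1
    hf m).hasFiniteSupport_of_discreteTopology

theorem summable_ite {ι : Type*} {f : ι → PS} (hf : Summable f) (p : ι → Prop) [DecidablePred p] :
    Summable fun i => if p i then f i else 0 := by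
  refine summable_of_finite _ fun m => (finite_of_summable hf m).subset fun i hi => ?_
  by_cases hp : p i
  · simpa [hp] using hi
  · simp [hp] at hi

open Classical in
/-- A sum graded by a statistic `len` with the terms of degree `0` left out. -/
theorem tsum_graded {ι : Type*} {f : ι → PS} (hf : Summable f) (len : ι → ℕ) :
    ∑' n : ℕ, ∑' i, (if len i = n + 1 then f i else 0) = ∑' i, if len i ≠ 0 then f i else 0 := by
  have h1 : Summable (Function.uncurry fun (i : ι) (n : ℕ) =>
      if len i = n + 1 then f i else 0) := by
    refine summable_of_finite _ fun m =>
      ((finite_of_summable hf m).image fun i => (i, len i - 1)).subset ?_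
    rintro ⟨i, n⟩ hin
    by_cases hp : len i = n + 1
    · exact ⟨i, by simpa [hp] using hin, by simp [hp]⟩
    · simp [hp] at hin
  rw [h1.tsum_comm' (fun i => summable_of_finite _ fun m => (Set.finite_singleton (len i - 1)).subset
    fun n hn => ?_) fun n => summable_ite hf _]
  · refine tsum_congr fun i => ?_
    rw [tsum_eq_single (len i - 1)]
    · refine if_congr ?_ rfl rfl
      omega
    · intro n hn
      exact if_neg (by omega)
  · by_cases hp : len i = n + 1
    · simp [hp]
    · simp [hp] at hn

/-! ### Generating functions by first letter -/

theorem zWord_cons (b : ℕ+) (v : Word) : zWord (b :: v) = z b * zWord v := by simp [zWord]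

theorem zWord_append (v w : Word) : zWord (v ++ w) = zWord v * zWord w := by simp [zWord]

open Classical in
/-- The term `t^{|w|} z^w x^{des(w)}` of a word over `A` without matches, `0` for other words. -/
noncomputable def wordTerm (R : Word → Word → Prop) (u : Word) (A : Set ℕ+) (w : Word) : PS :=
  if ∀ a ∈ w, a ∈ A then t ^ w.length * zWord w * avoidWt R u w else 0

open Classical in
/-- The contribution of the block `b p c` to the weight of the descent `b c`. -/
noncomputable def blockTerm (R : Word → Word → Prop) (u : Word) (A : Set ℕ+) (b c : ℕ+)
    (p : Word) : PS :=
  if ∀ a ∈ p, a ∈ A then t ^ p.length * zWord p * blockWt R u (b :: (p ++ [c])) else 0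

theorem zWord_dvd_wordTerm (R : Word → Word → Prop) (u : Word) (A : Set ℕ+) (w : Word) :
    zWord w ∣ wordTerm R u A w := by
  unfold wordTerm
  split_ifs
  · exact (Dvd.intro_left _ rfl).mul_right _
  · exact dvd_zero _

theorem zWord_dvd_blockTerm (R : Word → Word → Prop) (u : Word) (A : Set ℕ+) (b c : ℕ+)
    (p : Word) : zWord p ∣ blockTerm R u A b c p := by
  unfold blockTerm
  split_ifs
  · exact (Dvd.intro_left _ rfl).mul_right _
  · exact dvd_zero _

theorem cons_injective : Function.Injective fun p : ℕ+ × Word => p.1 :: p.2 := by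
  rintro ⟨b, v⟩ ⟨c, w⟩ h
  simpa using h

theorem summable_wordTerm (R : Word → Word → Prop) (u : Word) (A : Set ℕ+) :
    Summable (wordTerm R u A) :=
  summable_of_zWord_dvd_of_injective (g := id) Function.injective_id
    (zWord_dvd_wordTerm R u A)

theorem summable_wordTerm_cons (R : Word → Word → Prop) (u : Word) (A : Set ℕ+) :
    Summable fun p : ℕ+ × Word => wordTerm R u A (p.1 :: p.2) :=
  (summable_wordTerm R u A).comp_injective cons_injective

theorem summable_wordTerm_cons_right (R : Word → Word → Prop) (u : Word) (A : Set ℕ+) (b : ℕ+) :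
    Summable fun v => wordTerm R u A (b :: v) :=
  (summable_wordTerm R u A).comp_injective (List.cons_injective)

theorem summable_blockTerm (R : Word → Word → Prop) (u : Word) (A : Set ℕ+) (b c : ℕ+) :
    Summable (blockTerm R u A b c) :=
  summable_of_zWord_dvd_of_injective (g := id) Function.injective_id
    (zWord_dvd_blockTerm R u A b c)

/-- The generating function of the words without matches that start with `b`. -/
noncomputable def firstGF (R : Word → Word → Prop) (u : Word) (A : Set ℕ+) (b : ℕ+) : PS :=
  ∑' v, wordTerm R u A (b :: v)

theorem summable_firstGF (R : Word → Word → Prop) (u : Word) (A : Set ℕ+) :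
    Summable (firstGF R u A) :=
  ((summable_wordTerm_cons R u A).hasSum.prod_fiberwise fun b =>
    (summable_wordTerm_cons_right R u A b).hasSum).summable

theorem firstGF_eq_zero {R : Word → Word → Prop} {u : Word} {A : Set ℕ+} {b : ℕ+} (hb : b ∉ A) :
    firstGF R u A b = 0 := by
  unfold firstGF
  simp [wordTerm, hb]

/-- Since `|u| ≥ 2`, a block has two distinct end positions and reads `b p c`; `blockTerm` tests
only `p` for membership in `A`, hence the assumptions on `b` and `c`. -/
theorem wt_eq_tsum_blockTerm {R : Word → Word → Prop} {u : Word} {A : Set ℕ+} {b c : ℕ+}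
    (hu : 2 ≤ u.length) (hb : b ∈ A) (hc : c ∈ A) :
    wt R u A b c = ∑' p, blockTerm R u A b c p := by
  classical
  have hinj : Function.Injective fun p : Word => b :: (p ++ [c]) := fun p q h => by simpa using h
  let S : Set Word := {w | (∀ a ∈ w, a ∈ A) ∧ w.head? = some b ∧ w.getLast? = some c ∧
    IsLinkedBlock R u w}
  have h1 : wt R u A b c = ∑' w, S.indicator (fun w : Word =>
      (-x) ^ mch R u w * t ^ (w.length - 2) * zWord w.tail.dropLast) w := by
    rw [← tsum_subtype]
    rfl
  rw [h1, ← hinj.tsum_eq]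
  · refine tsum_congr fun p => ?_
    have hS : (b :: (p ++ [c])) ∈ S ↔ (∀ a ∈ p, a ∈ A) ∧ IsLinkedBlock R u (b :: (p ++ [c])) := by
      simp only [S, Set.mem_ofPred_eq, List.head?_cons, true_and]
      rw [← List.cons_append, List.getLast?_concat]
      simp only [true_and]
      refine and_congr_left fun _ => ?_
      constructor
      · intro h a ha
        exact h a (by simp [ha])
      · intro h a ha
        simp at ha
        rcases ha with rfl | ha | rfl
        exacts [hb, h a ha, hc]
    rw [Set.indicator_apply, blockTerm, blockWt]
    simp only [hS, List.length_cons, List.length_append, List.tail_cons, List.dropLast_concat]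
    by_cases hA : ∀ a ∈ p, a ∈ A
    · by_cases hB : IsLinkedBlock R u (b :: (p ++ [c]))
      · rw [if_pos ⟨hA, hB⟩, if_pos hA, if_pos hB]
        simp
        ring
      · rw [if_neg fun h => hB h.2, if_pos hA, if_neg hB, mul_zero]
    · rw [if_neg fun h => hA h.1, if_neg hA]
  · intro w hw
    have hw' : w ∈ S := Set.mem_of_indicator_ne_zero hw
    obtain ⟨-, hh, hl, hblk⟩ := hw'
    obtain ⟨v, rfl⟩ := List.head?_eq_some_iff.mp hh
    rcases List.eq_nil_or_concat v with rfl | ⟨p, d, rfl⟩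
    · have := hblk.1
      simp at this
      omega
    · refine ⟨p, ?_⟩
      rw [List.concat_eq_append, ← List.cons_append, List.getLast?_concat] at hl
      simp [Option.some.inj hl]

theorem blockTerm_eq_zero {R : Word → Word → Prop} {u : Word} (h : GoodPattern u)
    (hR : OrderIsoRel R u) {A : Set ℕ+} {b c : ℕ+} (hbc : b ≤ c) (p : Word) :
    blockTerm R u A b c p = 0 := by
  have h0 : blockWt R u (b :: (p ++ [c])) = 0 := if_neg fun hb => by
    have := hb.last_lt_first h hR
    simp at this
    exact absurd this (not_lt.2 hbc)
  simp [blockTerm, h0]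

/-- The contribution of a word that is prolonged on the left by a single letter `b`. -/
noncomputable def stepTerm (R : Word → Word → Prop) (u : Word) (A : Set ℕ+) (b : ℕ+) : Word → PS
  | [] => 0
  | c :: v => stepWt (c < b) * wordTerm R u A (c :: v)

/-- The decomposition of a single word with variables attached. The letter `v[i]` shared by block
and suffix is counted in the suffix only. -/
theorem wordTerm_cons {R : Word → Word → Prop} {u : Word} (h : GoodPattern u)
    (hR : OrderIsoRel R u) {A : Set ℕ+} {b : ℕ+} (hb : b ∈ A) (v : Word) :
    wordTerm R u A (b :: v) = t * z b * ((if v = [] then 1 else 0) +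
      stepTerm R u A b v +
      ∑ i : Fin v.length, blockTerm R u A b v[i] (v.take i) * wordTerm R u A (v.drop i)) := by
  cases v with
  | nil =>
    simp [wordTerm, stepTerm, hb, avoidWt_singleton h.two_le, zWord]
  | cons c v =>
    rw [Finset.sum_fin_eq_sum_range]
    by_cases hA : ∀ a ∈ c :: v, a ∈ A
    · have hA' : ∀ a ∈ b :: c :: v, a ∈ A := List.forall_mem_cons.2 ⟨hb, hA⟩
      rw [wordTerm, if_pos hA', avoidWt_cons_cons h hR]
      simp only [List.length_cons, stepTerm]
      rw [wordTerm, if_pos hA, if_neg (List.cons_ne_nil _ _), zero_add, mul_add, mul_add,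
        Finset.mul_sum, Finset.mul_sum]
      congr 1
      · rw [zWord_cons, List.length_cons]
        ring
      · refine Finset.sum_congr rfl fun i hi => ?_
        rw [Finset.mem_range] at hi
        have hi' : i < (c :: v).length := by simpa using hi
        rw [dif_pos hi, blockTerm, wordTerm, if_pos fun a ha => hA a (List.mem_of_mem_take ha),
          if_pos fun a ha => hA a (List.mem_of_mem_drop ha)]
        have h1 : zWord (b :: c :: v) =
            z b * (zWord ((c :: v).take i) * zWord ((c :: v).drop i)) := by
          rw [zWord_cons, ← zWord_append, List.take_append_drop]
        have h2 : t ^ (v.length + 1 + 1) =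
            t * (t ^ ((c :: v).take i).length * t ^ ((c :: v).drop i).length) := by
          rw [← pow_add, ← pow_succ', ← List.length_append, List.take_append_drop]
          rfl
        have h3 : (c :: v).take (i + 1) = (c :: v).take i ++ [(c :: v)[i]] :=
          (List.take_append_getElem hi').symm
        rw [h1, h2, h3]
        simp only [Fin.getElem_fin]
        ring
    · rw [wordTerm, if_neg fun hA' => hA fun a ha => hA' a (List.mem_cons_of_mem _ ha)]
      simp only [stepTerm]
      rw [wordTerm, if_neg hA, if_neg (List.cons_ne_nil _ _), Finset.sum_eq_zero]
      · ring
      · intro i hi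
        split_ifs with hi'
        · by_cases h1 : ∀ a ∈ (c :: v).drop i, a ∈ A
          · rw [blockTerm, if_neg, zero_mul]
            intro h2
            refine hA fun a ha => ?_
            rw [← List.take_append_drop i (c :: v), List.mem_append] at ha
            exact ha.elim (h2 a) (h1 a)
          · rw [wordTerm, if_neg h1, mul_zero]
        · rfl

/-- Splitting a word at one of its letters. -/
def splitEquiv : (Σ v : Word, Fin v.length) ≃ ℕ+ × Word × Word where
  toFun a := (a.1[a.2], a.1.take a.2, a.1.drop (a.2 + 1))
  invFun a := ⟨a.2.1 ++ a.1 :: a.2.2, ⟨a.2.1.length, by simp⟩⟩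
  left_inv := by
    rintro ⟨v, i, hi⟩
    have h1 : v.take i ++ v[i] :: v.drop (i + 1) = v := by simp
    refine Sigma.ext h1 ((Fin.heq_ext_iff (congrArg List.length h1)).2 ?_)
    simp [hi.le]
  right_inv := by
    rintro ⟨c, p, s⟩
    simp

theorem summable_split (R : Word → Word → Prop) (u : Word) (A : Set ℕ+) (b : ℕ+) :
    Summable fun a : Σ v : Word, Fin v.length =>
      blockTerm R u A b a.1[a.2] (a.1.take a.2) * wordTerm R u A (a.1.drop a.2) := by
  refine summable_of_zWord_dvd (g := Sigma.fst) (fun w => ?_) fun a => ?_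
  · refine (Set.finite_range fun i : Fin w.length => (⟨w, i⟩ : Σ v : Word, Fin v.length)).subset ?_
    rintro ⟨v, i⟩ rfl
    exact ⟨i, rfl⟩
  · have := mul_dvd_mul (zWord_dvd_blockTerm R u A b a.1[a.2] (a.1.take a.2))
      (zWord_dvd_wordTerm R u A (a.1.drop a.2))
    rwa [← zWord_append, List.take_append_drop] at this

/-- A word with a marked letter is a free triple (letter, part before, part after), so the double
sum factors for each marked letter `c`. -/
theorem hasSum_split (R : Word → Word → Prop) (u : Word) (A : Set ℕ+) (b : ℕ+) :
    HasSum (fun v : Word => ∑ i : Fin v.length,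
      blockTerm R u A b v[i] (v.take i) * wordTerm R u A (v.drop i))
      (∑' c, (∑' p, blockTerm R u A b c p) * firstGF R u A c) := by
  have h1 := summable_split R u A b
  have h2 := h1.hasSum.sigma fun v => hasSum_fintype _
  convert h2 using 1
  rw [← splitEquiv.symm.tsum_eq]
  have h3 := (splitEquiv.symm.summable_iff).2 h1
  have h4 : ∀ a : ℕ+ × Word × Word, blockTerm R u A b (splitEquiv.symm a).1[(splitEquiv.symm a).2]
      ((splitEquiv.symm a).1.take (splitEquiv.symm a).2) *
        wordTerm R u A ((splitEquiv.symm a).1.drop (splitEquiv.symm a).2) =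
      blockTerm R u A b a.1 a.2.1 * wordTerm R u A (a.1 :: a.2.2) := by
    rintro ⟨c, p, s⟩
    simp [splitEquiv]
  rw [tsum_congr h4]
  have h5 := h3.congr fun a => h4 a
  have h6 : ∀ c, Summable fun a : Word × Word =>
      blockTerm R u A b c a.1 * wordTerm R u A (c :: a.2) := fun c =>
    h5.comp_injective (i := fun a => (c, a)) fun _ _ h => (Prod.mk.inj h).2
  rw [h5.tsum_prod' h6]
  refine tsum_congr fun c => ?_
  exact (summable_blockTerm R u A b c).tsum_mul_tsum (summable_wordTerm_cons_right R u A c) (h6 c)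

theorem hasSum_step (R : Word → Word → Prop) (u : Word) (A : Set ℕ+) (b : ℕ+) :
    HasSum (stepTerm R u A b) (∑' c, stepWt (c < b) * firstGF R u A c) := by
  have h1 : Summable fun p : ℕ+ × Word => stepWt (p.1 < b) * wordTerm R u A (p.1 :: p.2) :=
    summable_of_zWord_dvd_of_injective cons_injective fun p =>
      (zWord_dvd_wordTerm R u A _).mul_left _
  have h2 : ∑' p : ℕ+ × Word, stepWt (p.1 < b) * wordTerm R u A (p.1 :: p.2) =
      ∑' c, stepWt (c < b) * firstGF R u A c := by
    rw [h1.tsum_prod' fun c => (summable_wordTerm_cons_right R u A c).mul_left (stepWt (c < b))]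
    exact tsum_congr fun c =>
      (summable_wordTerm_cons_right R u A c).tsum_mul_left (stepWt (c < b))
  rw [← h2]
  have h3 : ∀ v ∉ Set.range fun p : ℕ+ × Word => p.1 :: p.2, stepTerm R u A b v = 0 := by
    intro v hv
    cases v with
    | nil => rfl
    | cons c v => exact absurd ⟨(c, v), rfl⟩ hv
  have h4 : stepTerm R u A b ∘ (fun p : ℕ+ × Word => p.1 :: p.2) =
      fun p => stepWt (p.1 < b) * wordTerm R u A (p.1 :: p.2) := rfl
  rw [← cons_injective.hasSum_iff h3, h4]
  exact h1.hasSum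

theorem firstGF_eq {R : Word → Word → Prop} {u : Word} (h : GoodPattern u)
    (hR : OrderIsoRel R u) {A : Set ℕ+} {b : ℕ+} (hb : b ∈ A) :
    firstGF R u A b = t * z b * (1 + ∑' c, firstGF R u A c +
      ∑ c ∈ Finset.Iio b, (wt R u A b c + x - 1) * firstGF R u A c) := by
  have h1 := (((hasSum_ite_eq ([] : Word) (1 : PS)).add (hasSum_step R u A b)).add
    (hasSum_split R u A b)).mul_left (t * z b)
  have h2 : firstGF R u A b = _ := (tsum_congr fun v => wordTerm_cons h hR hb v).trans h1.tsum_eq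
  rw [h2]
  have h3 : ∑' c, (∑' p, blockTerm R u A b c p) * firstGF R u A c =
      ∑ c ∈ Finset.Iio b, wt R u A b c * firstGF R u A c := by
    rw [tsum_eq_sum (s := Finset.Iio b)]
    · refine Finset.sum_congr rfl fun c _ => ?_
      by_cases hc : c ∈ A
      · rw [wt_eq_tsum_blockTerm h.two_le hb hc]
      · rw [firstGF_eq_zero hc, mul_zero, mul_zero]
    · intro c hc
      rw [Finset.mem_Iio, not_lt] at hc
      rw [tsum_congr (blockTerm_eq_zero h hR hc), tsum_zero, zero_mul]
  -- The step weight is `1`, plus `x - 1` when `c < b`; this is the origin of `x - 1` in `DXTZ`.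
  have h4 : ∑' c, stepWt (c < b) * firstGF R u A c =
      ∑' c, firstGF R u A c + ∑ c ∈ Finset.Iio b, (x - 1) * firstGF R u A c := by
    have h5 : HasSum (fun c => if c ∈ Finset.Iio b then (x - 1) * firstGF R u A c else 0)
        (∑ c ∈ Finset.Iio b, (x - 1) * firstGF R u A c) := by
      rw [Finset.sum_congr rfl fun c hc => (if_pos hc).symm]
      exact hasSum_sum_of_ne_finset_zero fun c hc => if_neg hc
    rw [← ((summable_firstGF R u A).hasSum.add h5).tsum_eq]
    refine tsum_congr fun c => ?_
    simp only [Finset.mem_Iio, stepWt]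
    split_ifs <;> ring
  rw [h3, h4, add_assoc 1, add_assoc (∑' c, firstGF R u A c), ← Finset.sum_add_distrib,
    add_assoc 1]
  congr 4
  funext c
  ring

/-! ## Sums over finite sets, sorted by the largest element -/

/-- A nonempty subset of `Iio b` is its maximum `c` together with a subset of `Iio c`. -/
theorem sum_powerset_Iio {β : Type*} [AddCommMonoid β] (f : Finset ℕ+ → β) (b : ℕ+) :
    ∑ T ∈ (Finset.Iio b).powerset, f T =
      f ∅ + ∑ c ∈ Finset.Iio b, ∑ T ∈ (Finset.Iio c).powerset, f (insert c T) := by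
  induction b using PNat.recOn with
  | one =>
    simp
  | succ b ih =>
    have : Finset.Iio (b + 1) = insert b (Finset.Iio b) := by
      ext a
      rw [Finset.mem_insert, Finset.mem_Iio, Finset.mem_Iio, PNat.lt_add_one_iff, le_iff_eq_or_lt]
    rw [this, Finset.sum_powerset_insert (by simp), Finset.sum_insert (by simp), ih]
    abel

theorem sort_insert_of_lt {T : Finset ℕ+} {b : ℕ+} (h : ∀ a ∈ T, a < b) :
    (insert b T).sort = T.sort ++ [b] := by
  have hb : b ∉ T := fun hb => lt_irrefl b (h b hb)
  refine List.Perm.eq_of_pairwise (le := (· ≤ ·)) (fun a c _ _ => le_antisymm)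
    (Finset.pairwise_sort _ _) ?_ ?_
  · rw [List.pairwise_append]
    refine ⟨Finset.pairwise_sort _ _, List.pairwise_singleton _ _, fun a ha c hc => ?_⟩
    rw [List.mem_singleton.1 hc]
    exact (h a (by simpa using ha)).le
  · refine List.Perm.trans ?_ (List.perm_append_singleton b T.sort).symm
    rw [← Multiset.coe_eq_coe, Finset.sort_eq, Finset.insert_val_of_notMem hb, ← Multiset.cons_coe,
      Finset.sort_eq]

theorem zip_tail_concat (l : List ℕ+) (c b : ℕ+) :
    (l ++ [c, b]).zip (l ++ [c, b]).tail = (l ++ [c]).zip (l ++ [c]).tail ++ [(c, b)] := by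
  induction l with
  | nil => simp
  | cons a l ih =>
    cases l with
    | nil => simp
    | cons a' l => simpa using ih

theorem DXTZ_singleton (R : Word → Word → Prop) (u : Word) (A : Set ℕ+) (b : ℕ+) :
    DXTZ R u A {b} = z b := by
  simp [DXTZ]

/-- A new maximum creates exactly one new adjacent pair, with the old maximum `c`. -/
theorem DXTZ_insert_insert (R : Word → Word → Prop) (u : Word) (A : Set ℕ+) {b c : ℕ+}
    {T : Finset ℕ+} (hcb : c < b) (hT : ∀ a ∈ T, a < c) :
    DXTZ R u A (insert b (insert c T)) =
      z b * (wt R u A b c + x - 1) * DXTZ R u A (insert c T) := by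
  have h1 : ∀ a ∈ insert c T, a < b := fun a ha => by
    rcases Finset.mem_insert.1 ha with rfl | ha
    · exact hcb
    · exact (hT a ha).trans hcb
  unfold DXTZ
  rw [Finset.prod_insert fun h => lt_irrefl b (h1 b h), sort_insert_of_lt h1, sort_insert_of_lt hT,
    List.append_assoc, List.singleton_append, zip_tail_concat, List.map_append, List.prod_append]
  simp only [List.map_cons, List.map_nil, List.prod_singleton]
  ring

open Classical in
/-- The term `t^{|S|} DXTZ(S)` of a set `S ⊆ A`, `0` for other sets. -/
noncomputable def setTerm (R : Word → Word → Prop) (u : Word) (A : Set ℕ+) (S : Finset ℕ+) : PS :=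
  if (S : Set ℕ+) ⊆ A then t ^ S.card * DXTZ R u A S else 0

/-- The generating function of the sets with largest element `b`. -/
noncomputable def maxGF (R : Word → Word → Prop) (u : Word) (A : Set ℕ+) (b : ℕ+) : PS :=
  ∑ T ∈ (Finset.Iio b).powerset, setTerm R u A (insert b T)

theorem maxGF_eq_zero {R : Word → Word → Prop} {u : Word} {A : Set ℕ+} {b : ℕ+} (hb : b ∉ A) :
    maxGF R u A b = 0 :=
  Finset.sum_eq_zero fun T _ => if_neg fun h => hb (h (by simp))

theorem maxGF_eq {R : Word → Word → Prop} {u : Word} {A : Set ℕ+} {b : ℕ+} (hb : b ∈ A) :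
    maxGF R u A b = t * z b * (1 + ∑ c ∈ Finset.Iio b, (wt R u A b c + x - 1) * maxGF R u A c) := by
  unfold maxGF
  rw [sum_powerset_Iio, mul_add, mul_one, Finset.mul_sum]
  congr 1
  · simp [setTerm, hb, DXTZ_singleton]
  · refine Finset.sum_congr rfl fun c hc => ?_
    rw [Finset.mul_sum, Finset.mul_sum]
    refine Finset.sum_congr rfl fun T hT => ?_
    rw [Finset.mem_Iio] at hc
    have hT' : ∀ a ∈ T, a < c := fun a ha => Finset.mem_Iio.1 (Finset.mem_powerset.1 hT ha)
    have hbT : b ∉ insert c T := fun h => by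
      rcases Finset.mem_insert.1 h with rfl | h
      · exact lt_irrefl _ hc
      · exact lt_asymm hc (hT' b h)
    unfold setTerm
    rw [Finset.coe_insert, Set.insert_subset_iff, and_iff_right hb, DXTZ_insert_insert R u A hc hT',
      Finset.card_insert_of_notMem hbT]
    split_ifs
    · ring
    · ring

theorem summable_setTerm (R : Word → Word → Prop) (u : Word) (A : Set ℕ+) :
    Summable (setTerm R u A) := by
  classical
  refine summable_of_zWord_dvd_of_injective (g := fun S : Finset ℕ+ => S.sort) (fun S T h => ?_)
    fun S => ?_
  · simpa using congrArg List.toFinset h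
  · have h1 : zWord S.sort = ∏ j ∈ S, z j := by
      rw [zWord, ((Finset.sort_perm_toList S (· ≤ ·)).map z).prod_eq, Finset.prod_map_toList]
    unfold setTerm DXTZ
    rw [h1]
    split_ifs
    · exact (Dvd.intro _ rfl).mul_left _
    · exact dvd_zero _

/-- Nonempty finite sets correspond to pairs of a maximum `b` and a subset of `Iio b`. -/
theorem hasSum_maxGF (R : Word → Word → Prop) (u : Word) (A : Set ℕ+) :
    HasSum (maxGF R u A) (∑' S, if S.card ≠ 0 then setTerm R u A S else 0) := by
  let g : (Σ b : ℕ+, (Finset.Iio b).powerset) → Finset ℕ+ := fun a => insert a.1 a.2.1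
  have hlt : ∀ (b : ℕ+) (T : (Finset.Iio b).powerset), ∀ a ∈ T.1, a < b := fun b T a ha =>
    Finset.mem_Iio.1 (Finset.mem_powerset.1 T.2 ha)
  have hg : Function.Injective g := by
    rintro ⟨b, T⟩ ⟨b', T'⟩ h
    simp only [g] at h
    have h1 : b = b' := by
      have h2 : b ∈ insert b' T'.1 := h ▸ Finset.mem_insert_self _ _
      have h3 : b' ∈ insert b T.1 := h ▸ Finset.mem_insert_self _ _
      rw [Finset.mem_insert] at h2 h3
      rcases h2 with h2 | h2
      · exact h2
      · rcases h3 with h3 | h3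
        · exact h3.symm
        · exact absurd (hlt _ _ _ h2) (lt_asymm (hlt _ _ _ h3))
    subst h1
    have h4 : T.1 = T'.1 := by
      rw [← Finset.erase_insert fun hb => lt_irrefl b (hlt b T b hb), h,
        Finset.erase_insert fun hb => lt_irrefl b (hlt b T' b hb)]
    rw [Subtype.ext h4]
  have hs := summable_ite (summable_setTerm R u A) fun S => S.card ≠ 0
  have h0 : ∀ S ∉ Set.range g, (if S.card ≠ 0 then setTerm R u A S else 0) = 0 := by
    intro S hS
    rw [if_neg]
    rw [not_not, Finset.card_eq_zero]
    by_contra hne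
    have hne := Finset.nonempty_iff_ne_empty.2 hne
    refine hS ⟨⟨S.max' hne, ⟨S.erase (S.max' hne), ?_⟩⟩, Finset.insert_erase (S.max'_mem hne)⟩
    rw [Finset.mem_powerset]
    exact fun a ha => Finset.mem_Iio.2 (S.lt_max'_of_mem_erase_max' hne ha)
  have h1 := (hg.hasSum_iff h0).2 hs.hasSum
  refine h1.sigma fun b => ?_
  have h2 := hasSum_fintype fun T : (Finset.Iio b).powerset => setTerm R u A (insert b T.1)
  rw [Finset.sum_coe_sort (Finset.Iio b).powerset fun T => setTerm R u A (insert b T)] at h2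
  convert h2 using 1
  · funext T
    simp [g]
  · rfl

/-! ### The quotient formula -/

theorem setSum_eq (R : Word → Word → Prop) (u : Word) (A : Set ℕ+) :
    setSum R u A = ∑' S, if S.card ≠ 0 then setTerm R u A S else 0 := by
  classical
  rw [← tsum_graded (summable_setTerm R u A) Finset.card]
  refine tsum_congr fun n => ?_
  rw [← (summable_DXTZ R u A (n + 1)).tsum_mul_left]
  have := tsum_subtype {S : Finset ℕ+ | S.card = n + 1 ∧ (S : Set ℕ+) ⊆ A}
    fun S => t ^ (n + 1) * DXTZ R u A S
  refine Eq.trans this (tsum_congr fun S => ?_)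
  rw [Set.indicator_apply, setTerm, ← ite_and]
  refine if_ctx_congr Iff.rfl (fun h => ?_) fun _ => rfl
  rw [h.1]

theorem avoidGF_eq {R : Word → Word → Prop} {u : Word} (A : Set ℕ+) :
    avoidGF R u A = 1 + x * ∑' w, if w.length ≠ 0 then wordTerm R u A w else 0 := by
  classical
  unfold avoidGF
  rw [← (summable_ite (summable_wordTerm R u A) fun w => w.length ≠ 0).tsum_mul_left]
  simp only [mul_ite, mul_zero]
  rw [← tsum_graded ((summable_wordTerm R u A).mul_left x) List.length]
  congr 1
  refine tsum_congr fun n => ?_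
  rw [avoidSum, ← (summable_avoidSum R u A (n + 1)).tsum_mul_left]
  have := tsum_subtype {w : Word | w.length = n + 1 ∧ (∀ a ∈ w, a ∈ A) ∧ mch R u w = 0}
    fun w => t ^ (n + 1) * (x ^ (des w + 1) * zWord w)
  refine Eq.trans this (tsum_congr fun w => ?_)
  rw [Set.indicator_apply, wordTerm, avoidWt]
  by_cases h1 : w.length = n + 1
  · by_cases h2 : ∀ a ∈ w, a ∈ A
    · by_cases h3 : mch R u w = 0
      · rw [if_pos ⟨h1, h2, h3⟩, if_pos h1, if_pos h2, if_pos h3, h1]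
        ring
      · rw [if_neg fun h => h3 h.2.2, if_pos h1, if_pos h2, if_neg h3]
        ring
    · rw [if_neg fun h => h2 h.2.1, if_pos h1, if_neg h2, mul_zero]
  · rw [if_neg fun h => h1 h.1, if_neg h1]

theorem tsum_wordTerm_eq (R : Word → Word → Prop) (u : Word) (A : Set ℕ+) :
    ∑' w : Word, (if w.length ≠ 0 then wordTerm R u A w else 0) = ∑' b, firstGF R u A b := by
  have h1 := (summable_wordTerm_cons R u A).tsum_prod' (summable_wordTerm_cons_right R u A)
  unfold firstGF
  rw [← h1, ← cons_injective.tsum_eq]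
  · simp
  · intro w hw
    cases w with
    | nil => simp at hw
    | cons b v => exact ⟨(b, v), rfl⟩

/-- The recursions are linear and differ only in the inhomogeneous term, `1 + ∑' c, firstGF R u A c`
against `1`. -/
theorem firstGF_eq_maxGF_mul {R : Word → Word → Prop} {u : Word} (h : GoodPattern u)
    (hR : OrderIsoRel R u) (A : Set ℕ+) (b : ℕ+) :
    firstGF R u A b = maxGF R u A b * (1 + ∑' c, firstGF R u A c) := by
  induction b using PNat.strongInductionOn with
  | _ b ih =>
    by_cases hb : b ∈ A
    · rw [firstGF_eq h hR hb, maxGF_eq hb,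
        Finset.sum_congr rfl fun c hc => by rw [ih c (Finset.mem_Iio.1 hc), ← mul_assoc],
        ← Finset.sum_mul]
      ring
    · rw [firstGF_eq_zero hb, maxGF_eq_zero hb, zero_mul]

theorem avoidGF_mul {R : Word → Word → Prop} {u : Word} (h : GoodPattern u)
    (hR : OrderIsoRel R u) (A : Set ℕ+) :
    avoidGF R u A * (1 - setSum R u A) = 1 - (1 - x) * setSum R u A := by
  have h1 := (hasSum_maxGF R u A).mul_right (1 + ∑' c, firstGF R u A c)
  rw [← funext fun b => firstGF_eq_maxGF_mul h hR A b] at h1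
  have h2 := h1.tsum_eq
  rw [← setSum_eq] at h2
  rw [avoidGF_eq, tsum_wordTerm_eq]
  -- Here `h2` reads `F = G (1 + F)`, and the goal is `(1 + x F)(1 - G) = 1 - (1 - x) G`.
  linear_combination x * h2

/-- Every term of `setSum` is divisible by `t`, so the constant coefficient is `1`. -/
theorem isUnit_one_sub_setSum (R : Word → Word → Prop) (u : Word) (A : Set ℕ+) :
    IsUnit (1 - setSum R u A) := by
  rw [MvPowerSeries.isUnit_iff_constantCoeff, map_sub, map_one, setSum,
    (summable_t_pow _).map_tsum _ (MvPowerSeries.WithPiTopology.continuous_constantCoeff ℤ)]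
  simp [t]

/-! ## Setting variables to zero -/

theorem rescale_X (a : Var → ℤ) (v : Var) :
    MvPowerSeries.rescale a (MvPowerSeries.X v) = a v • (MvPowerSeries.X v : PS) := by
  classical
  ext m
  rw [MvPowerSeries.coeff_rescale, map_zsmul, smul_eq_mul, MvPowerSeries.coeff_X]
  split_ifs with h
  · rw [h, Finsupp.prod_single_index (h := fun s m => a s ^ m) (pow_zero _), pow_one]
  · simp

theorem setZero_x (k : ℕ) : setZero k x = x := (rescale_X _ _).trans (one_smul _ _)

theorem setZero_t (k : ℕ) : setZero k t = t := (rescale_X _ _).trans (one_smul _ _)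

open Classical in
theorem setZero_z (k : ℕ) (i : ℕ+) : setZero k (z i) = if i ∈ alphabet k then z i else 0 := by
  refine (rescale_X _ _).trans ?_
  by_cases h : i ∈ alphabet k
  · have h' : (i : ℕ) ≤ k := h
    simp [h, h', z]
  · have h' : ¬ (i : ℕ) ≤ k := h
    simp only [h, h', if_false, zero_smul]

/-- Continuity lets the substitution pass through the infinite sums, reducing each claim to single
terms. -/
theorem continuous_setZero (k : ℕ) : Continuous (setZero k) := by
  refine continuous_pi fun m => ?_
  have h : (fun f : PS => setZero k f m) = fun f => MvPowerSeries.coeff m (setZero k f) := rfl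
  rw [h]
  simp only [setZero, MvPowerSeries.coeff_rescale]
  exact continuous_const.mul (MvPowerSeries.WithPiTopology.continuous_coeff ℤ m)

theorem setZero_zWord (k : ℕ) (w : Word) [Decidable (∀ a ∈ w, a ∈ alphabet k)] :
    setZero k (zWord w) = if ∀ a ∈ w, a ∈ alphabet k then zWord w else 0 := by
  split_ifs with h
  · rw [zWord, map_list_prod, List.map_map]
    congr 1
    refine List.map_congr_left fun a ha => ?_
    simp [setZero_z, h a ha]
  · push Not at h
    obtain ⟨a, ha, hak⟩ := h
    have h1 : z a ∣ zWord w := List.dvd_prod (List.mem_map_of_mem ha)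
    have h2 := map_dvd (setZero k) h1
    rwa [setZero_z, if_neg hak, zero_dvd_iff] at h2

theorem setZero_avoidWt (R : Word → Word → Prop) (u : Word) (k : ℕ) (w : Word) :
    setZero k (avoidWt R u w) = avoidWt R u w := by
  unfold avoidWt
  split_ifs <;> simp [setZero_x]

theorem setZero_blockWt (R : Word → Word → Prop) (u : Word) (k : ℕ) (w : Word) :
    setZero k (blockWt R u w) = blockWt R u w := by
  unfold blockWt
  split_ifs <;> simp [setZero_x]

theorem setZero_wordTerm (R : Word → Word → Prop) (u : Word) (k : ℕ) (w : Word) :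
    setZero k (wordTerm R u Set.univ w) = wordTerm R u (alphabet k) w := by
  classical
  simp [wordTerm, setZero_t, setZero_zWord, setZero_avoidWt]

theorem setZero_blockTerm (R : Word → Word → Prop) (u : Word) (k : ℕ) (b c : ℕ+) (p : Word) :
    setZero k (blockTerm R u Set.univ b c p) = blockTerm R u (alphabet k) b c p := by
  classical
  simp [blockTerm, setZero_t, setZero_zWord, setZero_blockWt]

theorem setZero_wt (R : Word → Word → Prop) {u : Word} (hu : 2 ≤ u.length) {k : ℕ} {b c : ℕ+}
    (hb : b ∈ alphabet k) (hc : c ∈ alphabet k) :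
    setZero k (wt R u Set.univ b c) = wt R u (alphabet k) b c := by
  rw [wt_eq_tsum_blockTerm hu hb hc, wt_eq_tsum_blockTerm hu (Set.mem_univ _) (Set.mem_univ _),
    (summable_blockTerm R u _ b c).map_tsum _ (continuous_setZero k)]
  exact tsum_congr (setZero_blockTerm R u k b c)

theorem setZero_avoidGF (R : Word → Word → Prop) (u : Word) (k : ℕ) :
    setZero k (avoidGF R u Set.univ) = avoidGF R u (alphabet k) := by
  rw [avoidGF_eq, avoidGF_eq, map_add, map_one, map_mul, setZero_x,
    (summable_ite (summable_wordTerm R u _) _).map_tsum _ (continuous_setZero k)]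
  congr 3
  funext w
  rw [apply_ite (setZero k), map_zero, setZero_wordTerm]

theorem setZero_DXTZ (R : Word → Word → Prop) {u : Word} (hu : 2 ≤ u.length) {k : ℕ}
    {S : Finset ℕ+} (hS : (S : Set ℕ+) ⊆ alphabet k) :
    setZero k (DXTZ R u Set.univ S) = DXTZ R u (alphabet k) S := by
  unfold DXTZ
  rw [map_mul, map_prod, map_list_prod, List.map_map]
  congr 1
  · refine Finset.prod_congr rfl fun j hj => ?_
    rw [setZero_z, if_pos (hS hj)]
  · congr 1
    refine List.map_congr_left fun p hp => ?_
    obtain ⟨h1, h2⟩ := List.of_mem_zip (a := p.1) (b := p.2) hp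
    have h1' := hS ((Finset.mem_sort _).1 h1)
    have h2' := hS ((Finset.mem_sort _).1 (List.mem_of_mem_tail h2))
    simp [setZero_wt R hu h2' h1', setZero_x]

theorem setZero_setTerm (R : Word → Word → Prop) {u : Word} (hu : 2 ≤ u.length) (k : ℕ)
    (S : Finset ℕ+) : setZero k (setTerm R u Set.univ S) = setTerm R u (alphabet k) S := by
  unfold setTerm
  rw [if_pos (Set.subset_univ _), map_mul, map_pow, setZero_t]
  split_ifs with h
  · rw [setZero_DXTZ R hu h]
  -- A set with an element `a > k` carries the factor `z a`, which is sent to `0`.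
  · obtain ⟨a, ha, hak⟩ := Set.not_subset.1 h
    have h1 : z a ∣ DXTZ R u Set.univ S := (Finset.dvd_prod_of_mem z ha).mul_right _
    have h2 := map_dvd (setZero k) h1
    rw [setZero_z, if_neg hak, zero_dvd_iff] at h2
    rw [h2, mul_zero]

theorem setZero_setSum (R : Word → Word → Prop) {u : Word} (hu : 2 ≤ u.length) (k : ℕ) :
    setZero k (setSum R u Set.univ) = setSum R u (alphabet k) := by
  rw [setSum_eq, setSum_eq,
    (summable_ite (summable_setTerm R u _) _).map_tsum _ (continuous_setZero k)]
  congr 1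
  funext S
  rw [apply_ite (setZero k), map_zero, setZero_setTerm R hu]

end PatWord

theorem mainTheorem1 (u : Word) (hred : red u = u) (hdes : des u = 1)
    (hne : u ≠ []) (hends : u.getLast hne < u.head hne) :
    -- all positive integers: words without matches, and words without exact matches
    (IsUnit (1 - setSum IsMatch u Set.univ) ∧
      avoidGF IsMatch u Set.univ * (1 - setSum IsMatch u Set.univ) =
        1 - (1 - x) * setSum IsMatch u Set.univ) ∧
    (IsUnit (1 - setSum IsExactMatch u Set.univ) ∧
      avoidGF IsExactMatch u Set.univ * (1 - setSum IsExactMatch u Set.univ) =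
        1 - (1 - x) * setSum IsExactMatch u Set.univ) ∧
    -- the finite alphabet `[k]`, where `u` is a word over `[k]`
    ∀ k : ℕ, (∀ a ∈ u, a ∈ alphabet k) →
      (IsUnit (1 - setSum IsMatch u (alphabet k)) ∧
        avoidGF IsMatch u (alphabet k) * (1 - setSum IsMatch u (alphabet k)) =
          1 - (1 - x) * setSum IsMatch u (alphabet k)) ∧
      (IsUnit (1 - setSum IsExactMatch u (alphabet k)) ∧
        avoidGF IsExactMatch u (alphabet k) * (1 - setSum IsExactMatch u (alphabet k)) =
          1 - (1 - x) * setSum IsExactMatch u (alphabet k)) ∧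
      -- the quantities for `[k]` arise from the general ones by setting `z_i = 0` for `i > k`
      (setZero k (avoidGF IsMatch u Set.univ) = avoidGF IsMatch u (alphabet k) ∧
        setZero k (setSum IsMatch u Set.univ) = setSum IsMatch u (alphabet k) ∧
        ∀ S : Finset ℕ+, (S : Set ℕ+) ⊆ alphabet k →
          setZero k (DXTZ IsMatch u Set.univ S) = DXTZ IsMatch u (alphabet k) S) ∧
      (setZero k (avoidGF IsExactMatch u Set.univ) = avoidGF IsExactMatch u (alphabet k) ∧
        setZero k (setSum IsExactMatch u Set.univ) = setSum IsExactMatch u (alphabet k) ∧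
        ∀ S : Finset ℕ+, (S : Set ℕ+) ⊆ alphabet k →
          setZero k (DXTZ IsExactMatch u Set.univ S) = DXTZ IsExactMatch u (alphabet k) S) := by
  have hlen : 0 < u.length := List.length_pos_iff.2 hne
  have h : GoodPattern u := ⟨hdes, by
    rw [List.getD_eq_getElem _ _ (by omega), List.getD_eq_getElem _ _ hlen,
      ← List.getLast_eq_getElem hne, ← List.head_eq_getElem hne]
    exact hends⟩
  have hm := orderIsoRel_isMatch u
  have he := orderIsoRel_isExactMatch u
  exact ⟨⟨isUnit_one_sub_setSum _ _ _, avoidGF_mul h hm _⟩,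
    ⟨isUnit_one_sub_setSum _ _ _, avoidGF_mul h he _⟩, fun k _ =>
    ⟨⟨isUnit_one_sub_setSum _ _ _, avoidGF_mul h hm _⟩,
      ⟨isUnit_one_sub_setSum _ _ _, avoidGF_mul h he _⟩,
      ⟨setZero_avoidGF _ _ _, setZero_setSum _ h.two_le _, fun _ => setZero_DXTZ _ h.two_le⟩,
      ⟨setZero_avoidGF _ _ _, setZero_setSum _ h.two_le _, fun _ => setZero_DXTZ _ h.two_le⟩⟩⟩
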